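/- Let $X=(x_1,\dots,x_n)$, $n\ge 1$, be points in $\mathbb{R}^d$ (repetitions allowed), and for a finite nonempty set $C\subset\mathbb{R}^d$ let $\Phi(X,C)=\sum_{i=1}^n\min_{c\in C}\|x_i-c\|^2$. Let $\mathrm{OPT}_k(X)$ be the infimum of $\Phi(X,C)$ over all nonempty $C\subset\mathbb{R}^d$ with at most $k$ elements. For a nonempty set $C$ of data points with $\Phi(X,C)>0$, a $D^2$-sample with respect to $C$ is a random data point that equals the $i$-th one with probability $p_C(i)=\min_{c\in C}\|x_i-c\|^2/\Phi(X,C)$. Moderately greedy $k$-means++ with parameters $p\in[0,1]$ and $\ell\ge 1$ chooses its first center uniformly at random among the data points. In each of the following $k-1$ iterations, given the set $C$ of centers chosen so far, it does the following: with probability $p$, the next center is one $D^2$-sample with respect to $C$; with probability $1-p$, a tuple $S$ of $\ell$ independent $D^2$-samples with respect to $C$ is drawn, and the next center is a $u\in S$ minimizing $\Phi(X,C\cup\{u\})$, with ties broken by an arbitrary (possibly randomized) rule depending on $C$ and $S$. (If $\Phi(X,C)=0$, uniform sampling replaces $D^2$-sampling.) Let $T_k$ be the resulting set of centers. (1) For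 all $p\in[0,1]$, all $\ell\ge1$ and every nonempty set $C$ of data points with $\Phi(X,C)>0$, the probability $q_C(i)$ that an iteration started with center set $C$ chooses the $i$-th data point satisfies $$p\cdot p_C(i)\;\le\; q_C(i)\;\le\;\bigl((1-p)\ell+p\bigr)\cdot p_C(i)\qquad(1\le i\le n).$$ (2) For every $p\in(0,1]$ there is a constant $K>0$, depending only on $p$, such that for all $\ell\ge1$, all $k\ge2$ with $$\frac{k}{\ln k}\;\ge\;\max\Bigl\{18,\ \frac{24\,(1-p)\ell\,\bigl((1-p)\ell+p\bigr)}{p^2}\Bigr\},$$ all dimensions $d$, all data sets $X$ in $\mathbb{R}^d$ and all tie-breaking rules, $$\mathbb{E}\bigl[\Phi(X,T_k)\bigr]\;\le\;K\,\ell^3\,\ln^2(k)\cdot\mathrm{OPT}_k(X).$$ -/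

import Mathlib

open scoped ENNReal

namespace KMeans

noncomputable section

/-- Euclidean space of dimension `d`. -/
abbrev Pt (d : ℕ) : Type := EuclideanSpace ℝ (Fin d)

/-- `min_{c ∈ C} ‖x - c‖ ^ 2`, for a finite nonempty set of centers `C`. -/
def pointCost {d : ℕ} (x : Pt d) (C : Set (Pt d)) : ℝ :=
  ⨅ c : C, ‖x - (c : Pt d)‖ ^ 2

/-- The `k`-means cost of the data set `X` with respect to the set of centers `C`. A data set is
an indexed family of points (so points may be repeated); an injective family is a set. -/
def cost {ι : Type} [Fintype ι] {d : ℕ} (X : ι → Pt d) (C : Set (Pt d)) : ℝ :=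
  ∑ i, pointCost (X i) C

/-- The optimal `k`-means cost of `X`. Centers are arbitrary points of the space. As adding a
center never increases the cost, allowing fewer than `k` centers does not change the infimum over
sets of exactly `k` centers (as soon as such sets exist, i.e. unless `d = 0`). -/
def optCost {ι : Type} [Fintype ι] {d : ℕ} (k : ℕ) (X : ι → Pt d) : ℝ :=
  ⨅ C : {C : Finset (Pt d) // C.Nonempty ∧ C.card ≤ k}, cost X (C.1 : Set (Pt d))

/-- The current cost `Φ(X, C)`, where the centers chosen so far are the data points whose indices
lie in `C`. -/
def seedCost {ι : Type} [Fintype ι] {d : ℕ} (X : ι → Pt d) (C : Finset ι) : ℝ :=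
  cost X (X '' (C : Set ι))

/-- The `D²`-probability of data point `i` given the centers indexed by `C`. -/
def d2Prob {ι : Type} [Fintype ι] {d : ℕ} (X : ι → Pt d) (C : Finset ι) (i : ι) : ℝ :=
  pointCost (X i) (X '' (C : Set ι)) / seedCost X C

theorem pointCost_nonneg {d : ℕ} (x : Pt d) (C : Set (Pt d)) : 0 ≤ pointCost x C :=
  Real.iInf_nonneg fun _ => sq_nonneg _

theorem seedCost_nonneg {ι : Type} [Fintype ι] {d : ℕ} (X : ι → Pt d) (C : Finset ι) :
    0 ≤ seedCost X C :=
  Finset.sum_nonneg fun _ _ => pointCost_nonneg _ _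

theorem d2Prob_nonneg {ι : Type} [Fintype ι] {d : ℕ} (X : ι → Pt d) (C : Finset ι) (i : ι) :
    0 ≤ d2Prob X C i :=
  div_nonneg (pointCost_nonneg _ _) (seedCost_nonneg X C)

theorem sum_d2Prob {ι : Type} [Fintype ι] {d : ℕ} (X : ι → Pt d) (C : Finset ι)
    (h : 0 < seedCost X C) : ∑ i, ENNReal.ofReal (d2Prob X C i) = 1 := by
  rw [← ENNReal.ofReal_sum_of_nonneg fun i _ => d2Prob_nonneg X C i]
  simp only [d2Prob]
  rw [← Finset.sum_div]
  have : (∑ i, pointCost (X i) (X '' (C : Set ι))) = seedCost X C := rfl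
  rw [this, div_self h.ne', ENNReal.ofReal_one]

open Classical in
/-- `D²`-sampling with respect to the centers indexed by `C`. If all data points are already at
distance zero from a center, the `D²`-probabilities are not defined, and a uniform point is drawn
(any choice leaves the cost equal to zero). -/
def d2Sample {ι : Type} [Fintype ι] [Nonempty ι] {d : ℕ} (X : ι → Pt d) (C : Finset ι) : PMF ι :=
  if h : 0 < seedCost X C then
    PMF.ofFintype (fun i => ENNReal.ofReal (d2Prob X C i)) (sum_d2Prob X C h)
  else PMF.uniformOfFintype ι

/-- The law of `ℓ` independent samples from `μ`. -/
def iid {ι : Type} [Fintype ι] (ℓ : ℕ) (μ : PMF ι) : PMF (Fin ℓ → ι) :=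
  PMF.ofFintype (fun S => ∏ j, μ (S j)) (by
    have h := Finset.prod_univ_sum (fun _ : Fin ℓ => (Finset.univ : Finset ι))
      (fun _ i => μ i)
    have h1 : ∑ i, μ i = 1 := by rw [← tsum_fintype (L := .unconditional ι)]; exact μ.tsum_coe
    rw [Fintype.piFinset_univ] at h
    rw [← h]
    simp [h1])

/-- A coin that shows `true` with probability `p`. -/
def coin (p : Set.Icc (0 : ℝ) 1) : PMF Bool :=
  PMF.ofFintype (fun b => if b then ENNReal.ofReal p else ENNReal.ofReal (1 - p)) (by
    have h0 : (0 : ℝ) ≤ p := p.2.1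
    have h1 : (0 : ℝ) ≤ 1 - p := sub_nonneg.2 p.2.2
    simp [← ENNReal.ofReal_add h0 h1])

/-- `pick C S` is a version of `arg min_{u ∈ S} Φ(X, C ∪ {u})` for the sampled candidates
`S 0, …, S (ℓ - 1)`. Ties may be broken in an arbitrary, possibly random, way, which may depend on
`C` and `S`. -/
def IsArgminRule {ι : Type} [Fintype ι] [DecidableEq ι] {d : ℕ} (X : ι → Pt d) (ℓ : ℕ)
    (pick : Finset ι → (Fin ℓ → ι) → PMF ι) : Prop :=
  ∀ C S, ∀ u ∈ (pick C S).support,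
    (∃ j, S j = u) ∧ ∀ j, seedCost X (insert u C) ≤ seedCost X (insert (S j) C)

/-- The law of the center chosen in one iteration (after the first) of moderately greedy
`k`-means++ when the centers chosen so far are those indexed by `C`: with probability `p` one
`D²`-sample, and otherwise the best of `ℓ` independent `D²`-samples. -/
def step {ι : Type} [Fintype ι] [Nonempty ι] {d : ℕ} (X : ι → Pt d) (p : Set.Icc (0 : ℝ) 1)
    {ℓ : ℕ} (pick : Finset ι → (Fin ℓ → ι) → PMF ι) (C : Finset ι) : PMF ι :=
  (coin p).bind fun b =>
    if b then d2Sample X C else (iid ℓ (d2Sample X C)).bind fun S => pick C S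

/-- The law of the set of (indices of) centers after `k` iterations of moderately greedy
`k`-means++. -/
def centersLaw {ι : Type} [Fintype ι] [Nonempty ι] [DecidableEq ι] {d : ℕ} (X : ι → Pt d)
    (p : Set.Icc (0 : ℝ) 1) {ℓ : ℕ} (pick : Finset ι → (Fin ℓ → ι) → PMF ι) :
    ℕ → PMF (Finset ι)
  | 0 => PMF.pure ∅
  | 1 => (PMF.uniformOfFintype ι).map fun i => {i}
  | k + 2 => (centersLaw X p pick (k + 1)).bind fun C => (step X p pick C).map fun u => insert u C

/-- The expected cost `E[Φ(X, T_k)]` of the `k` centers computed by moderately greedy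
`k`-means++. -/
def expectedCost {ι : Type} [Fintype ι] [Nonempty ι] [DecidableEq ι] {d : ℕ} (X : ι → Pt d)
    (p : Set.Icc (0 : ℝ) 1) {ℓ : ℕ} (pick : Finset ι → (Fin ℓ → ι) → PMF ι) (k : ℕ) : ℝ :=
  ∑ C : Finset ι, (centersLaw X p pick k C).toReal * seedCost X C

end

end KMeans

/-! Part (1) is a union bound: a tuple of `ℓ` samples contains the `i`-th point with probability at
most `ℓ · p_C(i)`, and the plain `D²`-branch alone gives the lower bound. Part (2) sees the
algorithm only through these bounds, with `a = p` and `b = (1-p)ℓ+p` (`IsNoisySampling`).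

Fix a clustering with at most `k` clusters and reference centers `z`; a cluster is covered once it
contains a chosen center. Three estimates carry the proof.

Covering a cluster by exact `D²`-sampling leaves at most 8 times its reference cost in expectation,
and noise adds a factor `b/a`. Hence the covered cost plus `γ = 8b/a` times the reference cost of
the uncovered clusters is a supermartingale (`stepMean_coveredCost_add_le`).

An iteration that hits a covered cluster is wasted and is charged the average cost of an uncovered
cluster. Noise may prefer cheap uncovered clusters, so this average can grow; but expensive clusters
are likely to be hit, which limits the expected growth to a factor `M = (2b/a) log k + 3`
(`iterate_stepMean_average_le`).

A waste has probability at most `b · covered / Φ`, so with `u` uncovered clusters its expected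
charge is at most `b M · covered / u`. With `s` iterations still to follow, only the case `u ≥ s +
1` needs a charge, and summing `1/(s+1)` gives a harmonic number (`iterate_stepMean_seedCost_le`).
The two logarithms come from `M` and the harmonic sum, and `ℓ³` from `γ · b · (b/a)`. -/

namespace KMeans

set_option linter.unusedSectionVars false

/-! ### Squared distances to a set of centers -/

section PointCost

variable {d : ℕ}

theorem pointCost_le (x : Pt d) {C : Set (Pt d)} {c : Pt d} (hc : c ∈ C) :
    pointCost x C ≤ ‖x - c‖ ^ 2 :=
  ciInf_le (f := fun c : C => ‖x - (c : Pt d)‖ ^ 2)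
    ⟨0, by rintro _ ⟨y, rfl⟩; exact sq_nonneg _⟩ ⟨c, hc⟩

theorem pointCost_anti (x : Pt d) {C C' : Set (Pt d)} (hC : C.Nonempty) (h : C ⊆ C') :
    pointCost x C' ≤ pointCost x C := by
  have := hC.to_subtype
  exact le_ciInf fun c => pointCost_le x (h c.2)

theorem exists_pointCost_eq (x : Pt d) {C : Set (Pt d)} (hC : C.Nonempty) (hf : C.Finite) :
    ∃ c ∈ C, pointCost x C = ‖x - c‖ ^ 2 := by
  have := hC.to_subtype
  have := hf.to_subtype
  obtain ⟨c, hc⟩ := exists_eq_ciInf_of_finite (f := fun c : C => ‖x - (c : Pt d)‖ ^ 2)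
  exact ⟨c, c.2, hc.symm⟩

theorem pointCost_le_two_mul (x y : Pt d) {C : Set (Pt d)} (hC : C.Nonempty) (hf : C.Finite) :
    pointCost x C ≤ 2 * pointCost y C + 2 * ‖y - x‖ ^ 2 := by
  obtain ⟨c, hc, h⟩ := exists_pointCost_eq y hC hf
  have h1 := pointCost_le x hc
  have h2 : ‖x - c‖ ≤ ‖y - c‖ + ‖y - x‖ := by
    have := norm_sub_le (y - c) (y - x)
    simpa using this
  rw [h]
  nlinarith [norm_nonneg (x - c), sq_nonneg (‖y - c‖ - ‖y - x‖)]

/-- The sum of all squared distances in a family is at most twice its size times its cost with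
respect to any single center. -/
theorem sum_sum_norm_sub_sq_le {ι : Type} (A : Finset ι) (X : ι → Pt d) (c : Pt d) :
    ∑ i ∈ A, ∑ j ∈ A, ‖X j - X i‖ ^ 2 ≤ 2 * A.card * ∑ i ∈ A, ‖X i - c‖ ^ 2 := by
  have h : ∀ i j, ‖X j - X i‖ ^ 2
      = ‖X j - c‖ ^ 2 - 2 * inner ℝ (X j - c) (X i - c) + ‖X i - c‖ ^ 2 := by
    intro i j
    rw [← norm_sub_sq_real]
    congr 2
    abel
  have h2 : ∑ i ∈ A, ∑ j ∈ A, inner ℝ (X j - c) (X i - c) = ‖∑ i ∈ A, (X i - c)‖ ^ 2 := by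
    rw [← real_inner_self_eq_norm_sq, inner_sum]
    simp_rw [sum_inner]
  simp_rw [h, Finset.sum_add_distrib, Finset.sum_sub_distrib, ← Finset.mul_sum, h2]
  simp only [Finset.sum_const, nsmul_eq_mul, ← Finset.mul_sum]
  -- The difference of the two sides is exactly `2 ‖∑ (X i - c)‖²`.
  nlinarith [sq_nonneg ‖∑ i ∈ A, (X i - c)‖]

end PointCost

/-! ### Covered and uncovered clusters -/

section Clusters

variable {ι κ : Type} [Fintype ι] [DecidableEq κ] {d : ℕ}

/-- The cost of the cluster `{i | f i = c}` for the centers indexed by `C`. -/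
noncomputable def clusterCost (X : ι → Pt d) (f : ι → κ) (C : Finset ι) (c : κ) : ℝ :=
  ∑ i with f i = c, pointCost (X i) (X '' (C : Set ι))

/-- The cost of the cluster `{i | f i = c}` for the single center `z c`. -/
noncomputable def centerCost (X : ι → Pt d) (f : ι → κ) (z : κ → Pt d) (c : κ) : ℝ :=
  ∑ i with f i = c, ‖X i - z c‖ ^ 2

/-- The labels of the nonempty clusters that contain no center. -/
def uncovered (f : ι → κ) (C : Finset ι) : Finset κ := Finset.univ.image f \ C.image f

/-- The cost of the clusters that contain a center. -/
noncomputable def coveredCost (X : ι → Pt d) (f : ι → κ) (C : Finset ι) : ℝ :=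
  ∑ c ∈ C.image f, clusterCost X f C c

/-- The cost of the clusters that contain no center. -/
noncomputable def uncoveredCost (X : ι → Pt d) (f : ι → κ) (C : Finset ι) : ℝ :=
  ∑ c ∈ uncovered f C, clusterCost X f C c

variable (X : ι → Pt d) (f : ι → κ) (z : κ → Pt d)

theorem clusterCost_nonneg (C : Finset ι) (c : κ) : 0 ≤ clusterCost X f C c :=
  Finset.sum_nonneg fun _ _ => pointCost_nonneg _ _

theorem centerCost_nonneg (c : κ) : 0 ≤ centerCost X f z c :=
  Finset.sum_nonneg fun _ _ => sq_nonneg _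

theorem coveredCost_nonneg (C : Finset ι) : 0 ≤ coveredCost X f C :=
  Finset.sum_nonneg fun _ _ => clusterCost_nonneg X f C _

theorem uncoveredCost_nonneg (C : Finset ι) : 0 ≤ uncoveredCost X f C :=
  Finset.sum_nonneg fun _ _ => clusterCost_nonneg X f C _

theorem sum_eq_sum_image_fiber (g : ι → ℝ) :
    ∑ i, g i = ∑ c ∈ Finset.univ.image f, ∑ i with f i = c, g i :=
  (Finset.sum_fiberwise_of_maps_to (fun i _ => Finset.mem_image_of_mem f (Finset.mem_univ i))
    g).symm

theorem coveredCost_add_uncoveredCost (C : Finset ι) :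
    coveredCost X f C + uncoveredCost X f C = seedCost X C := by
  unfold seedCost cost
  rw [sum_eq_sum_image_fiber f, add_comm]
  exact Finset.sum_sdiff (Finset.image_subset_image (Finset.subset_univ C))

theorem uncoveredCost_le_seedCost (C : Finset ι) : uncoveredCost X f C ≤ seedCost X C := by
  linarith [coveredCost_add_uncoveredCost X f C, coveredCost_nonneg X f C]

theorem sum_covered_pointCost (C : Finset ι) :
    ∑ i with f i ∈ C.image f, pointCost (X i) (X '' (C : Set ι)) = coveredCost X f C := by
  rw [← Finset.sum_fiberwise_of_maps_to (g := f) (t := C.image f) (by simp)]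
  refine Finset.sum_congr rfl fun c hc => Finset.sum_congr ?_ fun _ _ => rfl
  ext i
  simp only [Finset.mem_filter, Finset.mem_univ, true_and, and_iff_right_iff_imp]
  rintro rfl
  exact hc

theorem sum_uncovered_pointCost (C : Finset ι) :
    ∑ i with f i ∉ C.image f, pointCost (X i) (X '' (C : Set ι)) = uncoveredCost X f C := by
  have h := Finset.sum_filter_add_sum_filter_not Finset.univ (fun i => f i ∈ C.image f)
    fun i => pointCost (X i) (X '' (C : Set ι))
  rw [sum_covered_pointCost] at h
  have h2 := coveredCost_add_uncoveredCost X f C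
  unfold seedCost cost at h2
  linarith

theorem mem_uncovered {C : Finset ι} {c : κ} :
    c ∈ uncovered f C ↔ (∃ i, f i = c) ∧ c ∉ C.image f := by
  simp [uncovered]

variable [DecidableEq ι]

theorem pointCost_insert_le (x : Pt d) {C : Finset ι} (hC : C.Nonempty) (i : ι) :
    pointCost x (X '' (insert i C : Finset ι)) ≤ pointCost x (X '' (C : Set ι)) :=
  pointCost_anti _ ((Finset.coe_nonempty.2 hC).image X) (Set.image_mono (by simp))

theorem clusterCost_insert_le {C : Finset ι} (hC : C.Nonempty) (i : ι) (c : κ) :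
    clusterCost X f (insert i C) c ≤ clusterCost X f C c :=
  Finset.sum_le_sum fun _ _ => pointCost_insert_le X _ hC i

theorem clusterCost_insert_le_sum (C : Finset ι) (i : ι) (c : κ) :
    clusterCost X f (insert i C) c ≤ ∑ j with f j = c, ‖X j - X i‖ ^ 2 :=
  Finset.sum_le_sum fun _ _ => pointCost_le _ ⟨i, by simp, rfl⟩

theorem image_insert_of_covered {C : Finset ι} {i : ι} (h : f i ∈ C.image f) :
    (insert i C).image f = C.image f := by
  rw [Finset.image_insert, Finset.insert_eq_self.2 h]

theorem uncovered_insert_of_covered {C : Finset ι} {i : ι} (h : f i ∈ C.image f) :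
    uncovered f (insert i C) = uncovered f C := by
  rw [uncovered, image_insert_of_covered f h, uncovered]

theorem uncovered_insert (C : Finset ι) (i : ι) :
    uncovered f (insert i C) = (uncovered f C).erase (f i) := by
  ext c
  simp only [mem_uncovered, Finset.image_insert, Finset.mem_insert, Finset.mem_erase]
  tauto

theorem card_uncovered_insert {C : Finset ι} {i : ι} (h : f i ∉ C.image f) :
    (uncovered f (insert i C)).card + 1 = (uncovered f C).card := by
  rw [uncovered_insert]
  exact Finset.card_erase_add_one ((mem_uncovered f).2 ⟨⟨i, rfl⟩, h⟩)

theorem uncoveredCost_insert_le {C : Finset ι} (hC : C.Nonempty) (i : ι) :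
    uncoveredCost X f (insert i C) ≤ uncoveredCost X f C := by
  unfold uncoveredCost
  rw [uncovered_insert]
  exact (Finset.sum_le_sum fun c _ => clusterCost_insert_le X f hC i c).trans
    (Finset.sum_le_sum_of_subset_of_nonneg (Finset.erase_subset _ _)
      fun c _ _ => clusterCost_nonneg X f C c)

/-- `D²`-sampling within a cluster reduces its cost to at most eight times the optimum in
expectation. -/
theorem sum_pointCost_mul_clusterCost_le {C : Finset ι} (hC : C.Nonempty) (c : κ) :
    ∑ i with f i = c, pointCost (X i) (X '' (C : Set ι)) * clusterCost X f (insert i C) c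
      ≤ 8 * centerCost X f z c * clusterCost X f C c := by
  set A : Finset ι := Finset.univ.filter fun i => f i = c with hA
  rcases A.eq_empty_or_nonempty with h0 | h0
  · rw [h0, Finset.sum_empty]
    exact mul_nonneg (mul_nonneg (by norm_num) (centerCost_nonneg X f z c))
      (clusterCost_nonneg X f C c)
  have hm : (0 : ℝ) < A.card := by exact_mod_cast h0.card_pos
  refine le_of_mul_le_mul_left ?_ hm
  rw [Finset.mul_sum]
  have key : ∀ i ∈ A, (A.card : ℝ) *
      (pointCost (X i) (X '' (C : Set ι)) * clusterCost X f (insert i C) c)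
      ≤ 4 * clusterCost X f C c * ∑ j ∈ A, ‖X j - X i‖ ^ 2 := by
    intro i _
    -- Averaging `pointCost_le_two_mul` over the cluster bounds the sampling weight of `i` by two
    -- terms.
    have h1 : (A.card : ℝ) * pointCost (X i) (X '' (C : Set ι))
        ≤ 2 * clusterCost X f C c + 2 * ∑ j ∈ A, ‖X j - X i‖ ^ 2 := by
      rw [← nsmul_eq_mul, ← Finset.sum_const, clusterCost, Finset.mul_sum, Finset.mul_sum,
        ← Finset.sum_add_distrib]
      exact Finset.sum_le_sum fun j _ =>
        pointCost_le_two_mul _ _ ((Finset.coe_nonempty.2 hC).image X) (Set.toFinite _)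
    have h2 := clusterCost_insert_le X f hC i c
    have h3 : clusterCost X f (insert i C) c ≤ ∑ j ∈ A, ‖X j - X i‖ ^ 2 :=
      clusterCost_insert_le_sum X f C i c
    have h4 := clusterCost_nonneg X f (insert i C) c
    have h5 := clusterCost_nonneg X f C c
    have h6 : 0 ≤ ∑ j ∈ A, ‖X j - X i‖ ^ 2 := Finset.sum_nonneg fun _ _ => sq_nonneg _
    -- The new cluster cost is bounded by the sum of distances to `X i` in the first term and by the
    -- old cluster cost in the second; each product contributes 2 to the factor 4.
    nlinarith [mul_le_mul_of_nonneg_right h1 h4, mul_le_mul_of_nonneg_left h3 h5,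
      mul_le_mul_of_nonneg_left h2 h6]
  refine (Finset.sum_le_sum key).trans ?_
  rw [← Finset.mul_sum]
  have h7 := mul_le_mul_of_nonneg_left (sum_sum_norm_sub_sq_le A X (z c))
    (mul_nonneg (by norm_num : (0 : ℝ) ≤ 4) (clusterCost_nonneg X f C c))
  refine h7.trans (le_of_eq ?_)
  rw [centerCost]
  ring

end Clusters

/-! ### Supermartingales and the cost recursion for noisy `D²`-sampling -/

section NoisySampling

variable {ι κ : Type} [Fintype ι] [DecidableEq ι] [DecidableEq κ] {d : ℕ}

/-- The expectation of `F` after one iteration, started at `C`, that chooses center `i` with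
probability `q C i`. -/
noncomputable def stepMean (q : Finset ι → ι → ℝ) (F : Finset ι → ℝ) (C : Finset ι) : ℝ :=
  ∑ i, q C i * F (insert i C)

/-- Noisy `D²`-sampling: `q C` is a probability distribution that agrees with the one of
`D²`-sampling up to the factors `a` and `b`. -/
structure IsNoisySampling (X : ι → Pt d) (a b : ℝ) (q : Finset ι → ι → ℝ) : Prop where
  nonneg : ∀ C i, 0 ≤ q C i
  sum_eq_one : ∀ C, ∑ i, q C i = 1
  lower : ∀ C : Finset ι, C.Nonempty → ∀ i,
    a * pointCost (X i) (X '' (C : Set ι)) ≤ q C i * seedCost X C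
  upper : ∀ C : Finset ι, C.Nonempty → ∀ i,
    q C i * seedCost X C ≤ b * pointCost (X i) (X '' (C : Set ι))

namespace IsNoisySampling

variable {X : ι → Pt d} {a b : ℝ} {q : Finset ι → ι → ℝ} (hq : IsNoisySampling X a b q)
include hq

theorem stepMean_le_add {F : Finset ι → ℝ} {C : Finset ι} {r : ℝ} {g : ι → ℝ}
    (h : ∀ i, F (insert i C) ≤ r + g i) : stepMean q F C ≤ r + ∑ i, q C i * g i := by
  calc stepMean q F C ≤ ∑ i, q C i * (r + g i) :=
        Finset.sum_le_sum fun i _ => mul_le_mul_of_nonneg_left (h i) (hq.nonneg C i)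
    _ = r + ∑ i, q C i * g i := by
        simp only [mul_add, Finset.sum_add_distrib, ← Finset.sum_mul, hq.sum_eq_one, one_mul]

theorem stepMean_mono {F G : Finset ι → ℝ} {C : Finset ι}
    (h : ∀ i, F (insert i C) ≤ G (insert i C)) : stepMean q F C ≤ stepMean q G C :=
  Finset.sum_le_sum fun i _ => mul_le_mul_of_nonneg_left (h i) (hq.nonneg C i)

/-- A supermartingale dominating `F` bounds its expectation at every later time. The invariant `P`
is there because both properties of `G` may hold only on the states reachable from the start. -/
theorem iterate_stepMean_le {F G : Finset ι → ℝ} (P : Finset ι → Prop)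
    (hP : ∀ C i, P C → P (insert i C)) (hFG : ∀ C, P C → F C ≤ G C)
    (hG : ∀ C, P C → stepMean q G C ≤ G C) (s : ℕ) :
    ∀ C, P C → (stepMean q)^[s] F C ≤ G C := by
  induction s with
  | zero => exact hFG
  | succ s ih =>
    intro C hC
    rw [Function.iterate_succ_apply']
    exact (hq.stepMean_mono fun i => ih _ (hP C i hC)).trans (hG C hC)

theorem iterate_stepMean_nonneg {F : Finset ι → ℝ} (hF : ∀ C, 0 ≤ F C) (s : ℕ) (C : Finset ι) :
    0 ≤ (stepMean q)^[s] F C := by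
  induction s generalizing C with
  | zero => exact hF C
  | succ s ih =>
    rw [Function.iterate_succ_apply']
    exact Finset.sum_nonneg fun i _ => mul_nonneg (hq.nonneg C i) (ih _)

theorem sum_filter_mul_seedCost_le {C : Finset ι} (hC : C.Nonempty) (P : ι → Prop)
    [DecidablePred P] :
    (∑ i with P i, q C i) * seedCost X C
      ≤ b * ∑ i with P i, pointCost (X i) (X '' (C : Set ι)) := by
  rw [Finset.sum_mul, Finset.mul_sum]
  exact Finset.sum_le_sum fun i _ => hq.upper C hC i

variable (f : ι → κ) (z : κ → Pt d)

theorem le_sum_cluster_mul_seedCost {C : Finset ι} (hC : C.Nonempty) (c : κ) :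
    a * clusterCost X f C c ≤ (∑ i with f i = c, q C i) * seedCost X C := by
  rw [Finset.sum_mul, clusterCost, Finset.mul_sum]
  exact Finset.sum_le_sum fun i _ => hq.lower C hC i

/-- The cost of the covered clusters, plus `γ` times the optimal cost of the uncovered ones, does
not increase in expectation. -/
theorem stepMean_coveredCost_add_le (ha : 0 < a) (hb : 0 ≤ b) {γ : ℝ} (hγ : 8 * b ≤ γ * a)
    {C : Finset ι} (hC : C.Nonempty) :
    stepMean q (fun C => coveredCost X f C + γ * ∑ c ∈ uncovered f C, centerCost X f z c) C
      ≤ coveredCost X f C + γ * ∑ c ∈ uncovered f C, centerCost X f z c := by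
  have hγ0 : 0 ≤ γ := by
    by_contra! h
    nlinarith
  -- `g i` bounds the change of the potential: hitting an uncovered cluster moves it to the covered
  -- side at its new cost and releases its share of `γ`. The expectation of `g` is then shown to be
  -- nonpositive cluster by cluster.
  refine (hq.stepMean_le_add (g := fun i => if f i ∈ C.image f then 0 else
    clusterCost X f (insert i C) (f i) - γ * centerCost X f z (f i)) fun i => ?_).trans
    (add_le_of_nonpos_right ?_)
  · by_cases h : f i ∈ C.image f
    · have : coveredCost X f (insert i C) ≤ coveredCost X f C := by
        unfold coveredCost
        rw [image_insert_of_covered f h]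
        exact Finset.sum_le_sum fun c _ => clusterCost_insert_le X f hC i c
      simp only [if_pos h, uncovered_insert_of_covered f h]
      linarith
    · have h1 : coveredCost X f (insert i C)
          ≤ coveredCost X f C + clusterCost X f (insert i C) (f i) := by
        unfold coveredCost
        rw [Finset.image_insert, Finset.sum_insert h, add_comm]
        gcongr with c
        exact clusterCost_insert_le X f hC i c
      have h2 : ∑ c ∈ uncovered f (insert i C), centerCost X f z c + centerCost X f z (f i)
          = ∑ c ∈ uncovered f C, centerCost X f z c := by
        rw [uncovered_insert]
        exact Finset.sum_erase_add _ _ ((mem_uncovered f).2 ⟨⟨i, rfl⟩, h⟩)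
      simp only [if_neg h, ← h2]
      linarith
  · rw [sum_eq_sum_image_fiber f]
    refine Finset.sum_nonpos fun c _ => ?_
    by_cases h : c ∈ C.image f
    · refine (Finset.sum_eq_zero fun i hi => ?_).le
      rw [(Finset.mem_filter.1 hi).2, if_pos h, mul_zero]
    have e : ∑ i with f i = c, q C i * (if f i ∈ C.image f then 0 else
          clusterCost X f (insert i C) (f i) - γ * centerCost X f z (f i))
        = ∑ i with f i = c, q C i * clusterCost X f (insert i C) c
          - γ * centerCost X f z c * ∑ i with f i = c, q C i := by
      rw [Finset.mul_sum, ← Finset.sum_sub_distrib]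
      refine Finset.sum_congr rfl fun i hi => ?_
      rw [(Finset.mem_filter.1 hi).2, if_neg h]
      ring
    rw [e, sub_nonpos]
    have ho := centerCost_nonneg X f z c
    -- At total cost zero the noise bounds say nothing about `q`, but all cluster costs vanish.
    rcases (seedCost_nonneg X C).eq_or_lt with h0 | h0
    · have hx : clusterCost X f C c ≤ 0 := by
        rw [h0]
        exact Finset.sum_le_sum_of_subset_of_nonneg (Finset.filter_subset _ _)
          fun _ _ _ => pointCost_nonneg _ _
      refine (Finset.sum_nonpos fun i _ => mul_nonpos_of_nonneg_of_nonpos (hq.nonneg C i)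
        ((clusterCost_insert_le X f hC i c).trans hx)).trans ?_
      exact mul_nonneg (mul_nonneg hγ0 ho) (Finset.sum_nonneg fun i _ => hq.nonneg C i)
    · refine le_of_mul_le_mul_right ?_ h0
      calc (∑ i with f i = c, q C i * clusterCost X f (insert i C) c) * seedCost X C
          = ∑ i with f i = c, (q C i * seedCost X C) * clusterCost X f (insert i C) c := by
            rw [Finset.sum_mul]
            exact Finset.sum_congr rfl fun _ _ => by ring
        _ ≤ ∑ i with f i = c, (b * pointCost (X i) (X '' (C : Set ι)))
              * clusterCost X f (insert i C) c :=
            Finset.sum_le_sum fun i _ =>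
              mul_le_mul_of_nonneg_right (hq.upper C hC i) (clusterCost_nonneg X f _ c)
        _ = b * ∑ i with f i = c, pointCost (X i) (X '' (C : Set ι))
              * clusterCost X f (insert i C) c := by
            rw [Finset.mul_sum]
            exact Finset.sum_congr rfl fun _ _ => by ring
        _ ≤ b * (8 * centerCost X f z c * clusterCost X f C c) :=
            mul_le_mul_of_nonneg_left (sum_pointCost_mul_clusterCost_le X f z hC c) hb
        _ = 8 * b * (centerCost X f z c * clusterCost X f C c) := by ring
        _ ≤ γ * a * (centerCost X f z c * clusterCost X f C c) :=
            mul_le_mul_of_nonneg_right hγ (mul_nonneg ho (clusterCost_nonneg X f C c))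
        _ = γ * centerCost X f z c * (a * clusterCost X f C c) := by ring
        _ ≤ γ * centerCost X f z c * ((∑ i with f i = c, q C i) * seedCost X C) :=
            mul_le_mul_of_nonneg_left (hq.le_sum_cluster_mul_seedCost f hC c)
              (mul_nonneg hγ0 ho)
        _ = _ := by ring

/-- The cost of the uncovered clusters whose cost is at least `θ`, weighted with an exponential
factor that grows with each newly covered cluster, does not increase in expectation. -/
theorem stepMean_large_le (ha : 0 < a) {β θ : ℝ} (hβ : 0 ≤ β) {C : Finset ι} (hC : C.Nonempty)
    (h : β * (b * uncoveredCost X f C) ≤ a * θ) :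
    stepMean q (fun C => Real.exp (-(β * (uncovered f C).card)) *
        ∑ c ∈ uncovered f C with θ ≤ clusterCost X f C c, clusterCost X f C c) C
      ≤ Real.exp (-(β * (uncovered f C).card)) *
        ∑ c ∈ uncovered f C with θ ≤ clusterCost X f C c, clusterCost X f C c := by
  simp only [Finset.sum_filter]
  -- A cluster that falls below `θ` contributes zero, so `w` can only decrease when a center is
  -- added.
  set w : Finset ι → κ → ℝ := fun C c =>
    if θ ≤ clusterCost X f C c then clusterCost X f C c else 0 with hw
  have hw0 : ∀ C c, 0 ≤ w C c := fun C c => by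
    simp only [hw]
    split_ifs
    exacts [clusterCost_nonneg X f C c, le_rfl]
  have hwi : ∀ i c, w (insert i C) c ≤ w C c := fun i c => by
    have h1 := clusterCost_insert_le X f hC i c
    have h2 := hw0 C c
    by_cases h3 : θ ≤ clusterCost X f (insert i C) c
    · simp only [hw, if_pos h3, if_pos (h3.trans h1), h1]
    · simpa only [hw, if_neg h3] using h2
  -- For uncovered `c`, the growth factor of its weighted contribution: 1 if a covered cluster is
  -- hit, `exp β` if another uncovered one is hit, 0 if `c` itself is hit.
  set m : ι → κ → ℝ := fun i c =>
    (1 - (if f i ∉ C.image f then 1 else 0))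
      + Real.exp β * ((if f i ∉ C.image f then 1 else 0) - (if f i = c then 1 else 0)) with hm
  have hins : ∀ i, Real.exp (-(β * (uncovered f (insert i C)).card)) *
      ∑ c ∈ uncovered f (insert i C), w (insert i C) c
      ≤ 0 + Real.exp (-(β * (uncovered f C).card)) * ∑ c ∈ uncovered f C, w C c * m i c := by
    intro i
    rw [zero_add]
    by_cases hi : f i ∈ C.image f
    · rw [uncovered_insert_of_covered f hi]
      refine mul_le_mul_of_nonneg_left (Finset.sum_le_sum fun c hc => ?_) (Real.exp_pos _).le
      have hne : f i ≠ c := by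
        rintro rfl
        exact ((mem_uncovered f).1 hc).2 hi
      simp only [hm, hi, hne, not_true_eq_false, if_false, sub_zero, mul_zero, add_zero, mul_one]
      exact hwi i c
    · have e : Real.exp (-(β * (uncovered f (insert i C)).card))
          = Real.exp (-(β * (uncovered f C).card)) * Real.exp β := by
        rw [← Real.exp_add, ← card_uncovered_insert f hi]
        congr 1
        push_cast
        ring
      rw [e, mul_assoc]
      refine mul_le_mul_of_nonneg_left ?_ (Real.exp_pos _).le
      rw [uncovered_insert, Finset.mul_sum,
        ← Finset.sum_erase_add (uncovered f C) _ ((mem_uncovered f).2 ⟨⟨i, rfl⟩, hi⟩)]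
      simp only [hm, hi, not_false_eq_true, if_true, sub_self, mul_zero, add_zero, zero_add]
      refine Finset.sum_le_sum fun c hc => ?_
      rw [if_neg (Finset.ne_of_mem_erase hc).symm, sub_zero, mul_one, mul_comm]
      exact mul_le_mul_of_nonneg_right (hwi i c) (Real.exp_pos _).le
  refine (hq.stepMean_le_add hins).trans ?_
  rw [zero_add]
  have e : ∑ i, q C i * (Real.exp (-(β * (uncovered f C).card)) *
        ∑ c ∈ uncovered f C, w C c * m i c)
      = Real.exp (-(β * (uncovered f C).card)) *
        ∑ c ∈ uncovered f C, w C c * ∑ i, q C i * m i c := by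
    simp only [Finset.mul_sum]
    rw [Finset.sum_comm]
    exact Finset.sum_congr rfl fun _ _ => Finset.sum_congr rfl fun _ _ => by ring
  rw [e]
  refine mul_le_mul_of_nonneg_left (Finset.sum_le_sum fun c hc => ?_) (Real.exp_pos _).le
  rcases (hw0 C c).eq_or_lt with h0 | h0
  · rw [← h0, zero_mul]
    exact hw0 C c
  have hθ : θ ≤ clusterCost X f C c := by
    by_contra h'
    simp only [hw, if_neg h', lt_self_iff_false] at h0
  have hx : 0 < clusterCost X f C c := by simpa only [hw, if_pos hθ] using h0
  have hΦ : 0 < seedCost X C := by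
    refine hx.trans_le ((Finset.single_le_sum (fun c _ => clusterCost_nonneg X f C c) hc).trans
      (uncoveredCost_le_seedCost X f C))
  refine mul_le_of_le_one_right h0.le ?_
  set Q := ∑ i with f i ∉ C.image f, q C i with hQ
  set qc := ∑ i with f i = c, q C i with hqc
  have hsum : ∑ i, q C i * m i c = (1 - Q) + Real.exp β * (Q - qc) := by
    simp only [hm, mul_add, mul_sub, Finset.sum_add_distrib, Finset.sum_sub_distrib, mul_one,
      hq.sum_eq_one, hQ, hqc, Finset.sum_filter, Finset.mul_sum]
    congr 2 <;> refine Finset.sum_congr rfl fun i _ => ?_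
    all_goals split_ifs <;> ring
  have hQ0 : 0 ≤ Q := Finset.sum_nonneg fun i _ => hq.nonneg C i
  -- A large cluster is hit with probability at least `a θ / Φ`, any uncovered one with probability
  -- at most `b · uncovered / Φ`. Then `exp β * (Q - qc) ≤ exp β * (1 - β) * Q ≤ Q`, so the mean
  -- factor is at most 1.
  have hβQ : β * Q ≤ qc := by
    refine le_of_mul_le_mul_right ?_ hΦ
    have h1 := hq.sum_filter_mul_seedCost_le hC fun i => f i ∉ C.image f
    rw [sum_uncovered_pointCost] at h1
    have h2 := hq.le_sum_cluster_mul_seedCost f hC c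
    have h3 := mul_le_mul_of_nonneg_left h1 hβ
    have h4 := mul_le_mul_of_nonneg_left hθ ha.le
    linarith
  have hexp : Real.exp β * (1 - β) ≤ 1 := by
    have h1 := Real.add_one_le_exp (-β)
    have h2 := mul_le_mul_of_nonneg_left h1 (Real.exp_pos β).le
    rw [← Real.exp_add, add_neg_cancel, Real.exp_zero] at h2
    linarith
  rw [hsum]
  have h5 := mul_le_mul_of_nonneg_right hexp hQ0
  have h6 := mul_le_mul_of_nonneg_left hβQ (Real.exp_pos β).le
  linarith

/-- The expected average cost of the uncovered clusters grows at most by a logarithmic factor. -/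
theorem iterate_stepMean_average_le (ha : 0 < a) (hb : 0 < b) {k : ℕ} (s : ℕ) {C : Finset ι}
    (hC : C.Nonempty) (hu : 0 < (uncovered f C).card) (huk : (uncovered f C).card ≤ k) :
    (stepMean q)^[s] (fun C => uncoveredCost X f C / (uncovered f C).card) C
      ≤ (2 * b / a * Real.log k + 3) * (uncoveredCost X f C / (uncovered f C).card) := by
  set u : ℝ := ((uncovered f C).card : ℝ) with hu_def
  set Φ := uncoveredCost X f C with hΦ
  set L := Real.log k with hL
  have hu0 : 0 < u := by rw [hu_def]; exact_mod_cast hu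
  have huk' : u ≤ k := by rw [hu_def]; exact_mod_cast huk
  have hk0 : (0 : ℝ) < k := hu0.trans_le huk'
  have hL0 : 0 ≤ L := Real.log_natCast_nonneg k
  have hΦ0 : 0 ≤ Φ := uncoveredCost_nonneg X f C
  -- `β` makes the weight `k⁻²` at the start and at least `k⁻¹` once half of the clusters are
  -- covered; `θ` is then forced by the condition `β b Φ = a θ`.
  set θ : ℝ := 2 * b / a * L * (Φ / u) with hθ
  have hθ0 : 0 ≤ θ := by positivity
  set β : ℝ := 2 * L / u with hβ
  have hβ0 : 0 ≤ β := by positivity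
  have hβθ : β * (b * Φ) = a * θ := by
    rw [hβ, hθ]
    field_simp
  set S : Finset ι → ℝ := fun C => Real.exp (-(β * (uncovered f C).card)) *
        ∑ c ∈ uncovered f C with θ ≤ clusterCost X f C c, clusterCost X f C c with hS
  have hlarge : ∀ C, 0 ≤ ∑ c ∈ uncovered f C with θ ≤ clusterCost X f C c,
      clusterCost X f C c := fun C => Finset.sum_nonneg fun c _ => clusterCost_nonneg X f C c
  have hS0 : ∀ C, 0 ≤ S C := fun C => mul_nonneg (Real.exp_pos _).le (hlarge C)
  have main := hq.iterate_stepMean_le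
    (F := fun C => uncoveredCost X f C / (uncovered f C).card)
    (G := fun C => (2 * (Φ / u) + θ) + k * S C)
    (fun C => C.Nonempty ∧ uncoveredCost X f C ≤ Φ)
    (fun C i h => ⟨Finset.insert_nonempty _ _, (uncoveredCost_insert_le X f h.1 i).trans h.2⟩)
    ?_ ?_ s C ⟨hC, le_rfl⟩
  · refine main.trans ?_
    have h1 : Real.exp (-(β * u)) = (k : ℝ)⁻¹ * (k : ℝ)⁻¹ := by
      have hkL : Real.exp (-L) = (k : ℝ)⁻¹ := by rw [Real.exp_neg, Real.exp_log hk0]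
      rw [← hkL, ← Real.exp_add]
      congr 1
      rw [hβ]
      field_simp
      ring
    have h2 : ∑ c ∈ uncovered f C with θ ≤ clusterCost X f C c, clusterCost X f C c ≤ Φ :=
      Finset.sum_le_sum_of_subset_of_nonneg (Finset.filter_subset _ _)
        fun c _ _ => clusterCost_nonneg X f C c
    have h3 : k * S C ≤ Φ / u := by
      calc k * S C ≤ k * ((k : ℝ)⁻¹ * (k : ℝ)⁻¹ * Φ) := by
            simp only [hS, ← hu_def, h1]
            gcongr
        _ = Φ / k := by field_simp
        _ ≤ Φ / u := div_le_div_of_nonneg_left hΦ0 hu0 huk'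
    calc 2 * (Φ / u) + θ + k * S C ≤ 2 * (Φ / u) + θ + Φ / u := by gcongr
      _ = _ := by rw [hθ]; ring
  · rintro D ⟨_, hDΦ⟩
    have hSD := mul_nonneg hk0.le (hS0 D)
    have hμ : 0 ≤ Φ / u := div_nonneg hΦ0 hu0.le
    rcases Nat.eq_zero_or_pos (uncovered f D).card with hD | hD
    · simp only [hD, Nat.cast_zero, div_zero]
      positivity
    have hD1 : (1 : ℝ) ≤ (uncovered f D).card := by exact_mod_cast hD
    have hD0 : (0 : ℝ) < (uncovered f D).card := by exact_mod_cast hD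
    -- While at least half of the initial clusters are uncovered, the average has at most doubled.
    -- Afterwards the small clusters average at most `θ`, and the large ones are paid for by `k * S
    -- D`.
    rcases le_total u (2 * (uncovered f D).card) with h | h
    · have : uncoveredCost X f D / (uncovered f D).card ≤ 2 * (Φ / u) := by
        rw [div_le_iff₀ hD0]
        refine hDΦ.trans ?_
        have := mul_le_mul_of_nonneg_left h hμ
        rw [div_mul_cancel₀ _ hu0.ne'] at this
        linarith
      linarith
    · set T := ∑ c ∈ uncovered f D with θ ≤ clusterCost X f D c, clusterCost X f D c with hT
      have h1 : uncoveredCost X f D ≤ (uncovered f D).card * θ + T := by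
        rw [← nsmul_eq_mul, ← Finset.sum_const, hT, Finset.sum_filter, ← Finset.sum_add_distrib]
        refine Finset.sum_le_sum fun c _ => ?_
        split_ifs with h'
        · linarith
        · linarith
      have h2 : 1 ≤ k * Real.exp (-(β * (uncovered f D).card)) := by
        rw [Real.exp_neg, ← div_eq_mul_inv, one_le_div (Real.exp_pos _),
          ← Real.le_log_iff_exp_le hk0, hβ, div_mul_eq_mul_div, div_le_iff₀ hu0]
        nlinarith
      have h3 : T ≤ k * S D := by
        rw [hS, ← mul_assoc]
        exact le_mul_of_one_le_left (hlarge D) h2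
      have h4 : uncoveredCost X f D / (uncovered f D).card ≤ θ + T := by
        rw [div_le_iff₀ hD0]
        nlinarith [mul_le_mul_of_nonneg_left hD1 (hlarge D)]
      linarith
  · rintro D ⟨hDne, hDΦ⟩
    have h1 := hq.stepMean_large_le f ha hβ0 hDne
      ((mul_le_mul_of_nonneg_left (mul_le_mul_of_nonneg_left hDΦ hb.le) hβ0).trans hβθ.le)
    have h2 : stepMean q (fun C => (2 * (Φ / u) + θ) + k * S C) D
        = (2 * (Φ / u) + θ) + k * stepMean q S D := by
      simp only [stepMean, mul_add, Finset.sum_add_distrib, ← Finset.sum_mul, hq.sum_eq_one,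
        one_mul, Finset.mul_sum, add_right_inj]
      exact Finset.sum_congr rfl fun _ _ => by ring
    rw [h2]
    gcongr

/-- The expected cost after `s` further iterations. -/
theorem iterate_stepMean_seedCost_le (ha : 0 < a) (hb : 0 < b) {γ : ℝ} (hγ : 8 * b ≤ γ * a)
    {k : ℕ} (s : ℕ) {C : Finset ι} (hC : C.Nonempty) (huk : (uncovered f C).card ≤ k) :
    (stepMean q)^[s] (seedCost X) C
      ≤ ((uncovered f C).card - s : ℕ) *
          (stepMean q)^[s] (fun C => uncoveredCost X f C / (uncovered f C).card) C
        + (1 + b * (2 * b / a * Real.log k + 3) * (harmonic s : ℝ)) *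
          (coveredCost X f C + γ * ∑ c ∈ uncovered f C, centerCost X f z c) := by
  have hγ0 : 0 ≤ γ := by
    by_contra! h
    nlinarith
  have hL0 : 0 ≤ Real.log k := Real.log_natCast_nonneg k
  set M : ℝ := 2 * b / a * Real.log k + 3 with hM
  have hM0 : 0 ≤ M := by positivity
  have hN0 : ∀ C, 0 ≤ γ * ∑ c ∈ uncovered f C, centerCost X f z c := fun C =>
    mul_nonneg hγ0 (Finset.sum_nonneg fun c _ => centerCost_nonneg X f z c)
  induction s generalizing C with
  | zero =>
    simp only [Function.iterate_zero, id, Nat.sub_zero, harmonic_zero, Rat.cast_zero, mul_zero,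
      add_zero, one_mul, ← coveredCost_add_uncoveredCost X f C]
    have h1 : uncoveredCost X f C
        ≤ (uncovered f C).card * (uncoveredCost X f C / (uncovered f C).card) := by
      rcases Nat.eq_zero_or_pos (uncovered f C).card with h | h
      · rw [uncoveredCost, Finset.card_eq_zero.1 h]
        simp
      · rw [mul_div_cancel₀]
        exact_mod_cast h.ne'
    linarith [hN0 C]
  | succ s ih =>
    set V := (stepMean q)^[s] (fun C => uncoveredCost X f C / (uncovered f C).card) with hV
    have hV0 : ∀ C, 0 ≤ V C := hq.iterate_stepMean_nonneg
      (fun C => div_nonneg (uncoveredCost_nonneg X f C) (Nat.cast_nonneg _)) s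
    set N : Finset ι → ℝ := fun C =>
      coveredCost X f C + γ * ∑ c ∈ uncovered f C, centerCost X f z c with hN
    have hH0 : (0 : ℝ) ≤ (harmonic s : ℝ) := by
      rw [harmonic]
      push_cast
      positivity
    rw [Function.iterate_succ_apply', Function.iterate_succ_apply', ← hV]
    -- The charge for a wasted iteration: one more average, due only if the uncovered clusters
    -- outnumber the `s` iterations that follow.
    set e : ι → ℝ := fun i => if f i ∈ C.image f ∧ s + 1 ≤ (uncovered f C).card then
      V (insert i C) else 0 with he
    have hpt : ∀ i, (stepMean q)^[s] (seedCost X) (insert i C)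
        ≤ ((uncovered f C).card - (s + 1) : ℕ) * V (insert i C) + e i
          + (1 + b * M * (harmonic s : ℝ)) * N (insert i C) := by
      intro i
      have hcard : (uncovered f (insert i C)).card ≤ (uncovered f C).card := by
        rw [uncovered_insert]
        exact Finset.card_erase_le
      refine (ih (Finset.insert_nonempty _ _) (hcard.trans huk)).trans ?_
      gcongr
      -- The truncated difference `u - s` absorbs a successful hit, since `u` drops by one; after a
      -- waste it exceeds `u - (s + 1)` by one, unless both are zero.
      by_cases hi : f i ∈ C.image f
      · rw [uncovered_insert_of_covered f hi]
        by_cases hs : s + 1 ≤ (uncovered f C).card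
        · have : (uncovered f C).card - s = (uncovered f C).card - (s + 1) + 1 := by omega
          simp only [he, hi, hs, and_self, if_true, this]
          push_cast
          linarith
        · have : (uncovered f C).card - s = (uncovered f C).card - (s + 1) := by omega
          simp only [he, hs, and_false, if_false, this, add_zero, le_refl]
      · have : (uncovered f (insert i C)).card - s = (uncovered f C).card - (s + 1) := by
          rw [← card_uncovered_insert f hi]
          omega
        simp only [he, hi, false_and, if_false, this, add_zero, le_refl]
    have hsum : ∑ i, q C i * e i ≤ b * M * (N C / (s + 1)) := by
      have hNC : coveredCost X f C ≤ N C := by simpa [hN] using hN0 C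
      have hNC0 := (coveredCost_nonneg X f C).trans hNC
      by_cases hs : s + 1 ≤ (uncovered f C).card
      · have hu : (s : ℝ) + 1 ≤ (uncovered f C).card := by exact_mod_cast hs
        have hu0 : (0 : ℝ) < (uncovered f C).card := lt_of_lt_of_le (by positivity) hu
        set u : ℝ := ((uncovered f C).card : ℝ) with hu_def
        have h1 : ∀ i, q C i * e i
            ≤ (if f i ∈ C.image f then q C i else 0) * (M * (uncoveredCost X f C / u)) := by
          intro i
          by_cases hi : f i ∈ C.image f
          · simp only [he, hi, hs, and_self, if_true]
            refine mul_le_mul_of_nonneg_left ?_ (hq.nonneg C i)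
            have h2 := hq.iterate_stepMean_average_le f ha hb (k := k) s
              (Finset.insert_nonempty i C)
              (by rw [uncovered_insert_of_covered f hi]; omega)
              (by rwa [uncovered_insert_of_covered f hi])
            refine h2.trans ?_
            rw [uncovered_insert_of_covered f hi, ← hM]
            gcongr
            exact uncoveredCost_insert_le X f hC i
          · simp only [he, hi, false_and, if_false, mul_zero, zero_mul, le_refl]
        refine (Finset.sum_le_sum fun i _ => h1 i).trans ?_
        rw [← Finset.sum_mul, ← Finset.sum_filter]
        have h3 := hq.sum_filter_mul_seedCost_le hC fun i => f i ∈ C.image f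
        rw [sum_covered_pointCost] at h3
        -- The total cost in the denominator of the waste probability cancels the uncovered cost in
        -- the average.
        have h4 : (∑ i with f i ∈ C.image f, q C i) * uncoveredCost X f C
            ≤ b * coveredCost X f C :=
          (mul_le_mul_of_nonneg_left (uncoveredCost_le_seedCost X f C)
            (Finset.sum_nonneg fun i _ => hq.nonneg C i)).trans h3
        calc (∑ i with f i ∈ C.image f, q C i) * (M * (uncoveredCost X f C / u))
            = M * (((∑ i with f i ∈ C.image f, q C i) * uncoveredCost X f C) / u) := by ring
          _ ≤ M * ((b * N C) / (s + 1)) :=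
              mul_le_mul_of_nonneg_left (div_le_div₀ (mul_nonneg hb.le hNC0)
                (h4.trans (mul_le_mul_of_nonneg_left hNC hb.le)) (by positivity) hu) hM0
          _ = _ := by ring
      · refine (Finset.sum_eq_zero fun i _ => ?_).le.trans (by positivity)
        simp only [he, hs, and_false, if_false, mul_zero]
    have hNstep : stepMean q N C ≤ N C := hq.stepMean_coveredCost_add_le f z ha hb.le hγ hC
    calc stepMean q ((stepMean q)^[s] (seedCost X)) C
        ≤ ∑ i, q C i * (((uncovered f C).card - (s + 1) : ℕ) * V (insert i C) + e i
          + (1 + b * M * (harmonic s : ℝ)) * N (insert i C)) :=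
          Finset.sum_le_sum fun i _ => mul_le_mul_of_nonneg_left (hpt i) (hq.nonneg C i)
      _ = ((uncovered f C).card - (s + 1) : ℕ) * stepMean q V C + ∑ i, q C i * e i
          + (1 + b * M * (harmonic s : ℝ)) * stepMean q N C := by
          simp only [stepMean, mul_add, Finset.sum_add_distrib, Finset.mul_sum]
          congr 1
          · congr 1
            exact Finset.sum_congr rfl fun _ _ => by ring
          · exact Finset.sum_congr rfl fun _ _ => by ring
      _ ≤ ((uncovered f C).card - (s + 1) : ℕ) * stepMean q V C + b * M * (N C / (s + 1))
          + (1 + b * M * (harmonic s : ℝ)) * N C := by gcongr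
      _ = _ := by
          rw [harmonic_succ]
          push_cast
          ring

end IsNoisySampling

end NoisySampling

/-! ### The law of one iteration and of the chosen centers -/

section Law

variable {ι : Type} [Fintype ι] {d : ℕ}

/-- Multiplied out, the identity survives total cost zero, where `d2Prob` is a division by zero and
every point has cost zero. -/
theorem d2Prob_mul_seedCost (X : ι → Pt d) (C : Finset ι) (i : ι) :
    d2Prob X C i * seedCost X C = pointCost (X i) (X '' (C : Set ι)) := by
  rcases (seedCost_nonneg X C).eq_or_lt with h | h
  · rw [← h, mul_zero]
    refine le_antisymm (pointCost_nonneg _ _) ?_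
    rw [h]
    exact Finset.single_le_sum (f := fun i => pointCost (X i) (X '' (C : Set ι)))
      (fun _ _ => pointCost_nonneg _ _) (Finset.mem_univ i)
  · exact div_mul_cancel₀ _ h.ne'

theorem toReal_d2Sample [Nonempty ι] (X : ι → Pt d) {C : Finset ι} (h : 0 < seedCost X C)
    (i : ι) : (d2Sample X C i).toReal = d2Prob X C i := by
  rw [d2Sample, dif_pos h, PMF.ofFintype_apply, ENNReal.toReal_ofReal (d2Prob_nonneg X C i)]

theorem sum_iid_eq [DecidableEq ι] (ℓ : ℕ) (μ : PMF ι) (j : Fin ℓ) (i : ι) :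
    ∑ S, iid ℓ μ S * (if S j = i then 1 else 0) = μ i := by
  have h1 : ∑ i, μ i = 1 := by rw [← tsum_fintype (L := .unconditional ι)]; exact μ.tsum_coe
  -- The indicator is put into the `j`-th factor only, so that the sum over tuples factorizes.
  have h := Finset.prod_univ_sum (fun _ : Fin ℓ => (Finset.univ : Finset ι))
    fun j' x => μ x * (if j' = j then (if x = i then 1 else 0) else 1)
  rw [Fintype.piFinset_univ] at h
  have h2 : ∀ j' : Fin ℓ, ∑ x, μ x * (if j' = j then (if x = i then (1 : ℝ≥0∞) else 0) else 1)
      = if j' = j then μ i else 1 := by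
    intro j'
    by_cases hj : j' = j
    · simp [hj]
    · simp [hj, h1]
  simp only [h2, Finset.prod_mul_distrib, Finset.prod_ite_eq', Finset.mem_univ, if_true] at h
  rw [h]
  rfl

/-- Union bound over the positions in the tuple at which `i` may appear. -/
theorem sum_iid_mul_le {ℓ : ℕ} (μ : PMF ι) (pick : (Fin ℓ → ι) → PMF ι)
    (hpick : ∀ S, ∀ u ∈ (pick S).support, ∃ j, S j = u) (i : ι) :
    ((iid ℓ μ).bind pick) i ≤ ℓ * μ i := by
  classical
  rw [PMF.bind_apply, tsum_fintype]
  calc ∑ S, iid ℓ μ S * pick S i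
      ≤ ∑ S, iid ℓ μ S * ∑ j, (if S j = i then 1 else 0) := by
        refine Finset.sum_le_sum fun S _ => mul_le_mul_right ?_ _
        by_cases h : i ∈ (pick S).support
        · obtain ⟨j, hj⟩ := hpick S i h
          refine ((pick S).coe_le_one i).trans ?_
          refine le_trans ?_ (Finset.single_le_sum (f := fun j => if S j = i then (1 : ℝ≥0∞) else 0)
            (fun _ _ => zero_le) (Finset.mem_univ j))
          simp [hj]
        · rw [(PMF.apply_eq_zero_iff _ _).2 h]
          exact zero_le
    _ = ∑ j : Fin ℓ, ∑ S, iid ℓ μ S * (if S j = i then 1 else 0) := by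
        simp only [Finset.mul_sum]
        exact Finset.sum_comm
    _ = ℓ * μ i := by 
        simp only [sum_iid_eq, Finset.sum_const, Finset.card_univ, Fintype.card_fin, nsmul_eq_mul]

variable [Nonempty ι] (X : ι → Pt d) (p : Set.Icc (0 : ℝ) 1) {ℓ : ℕ}
  (pick : Finset ι → (Fin ℓ → ι) → PMF ι)

theorem step_apply (C : Finset ι) (i : ι) :
    step X p pick C i = ENNReal.ofReal p * d2Sample X C i
      + ENNReal.ofReal (1 - p) * ((iid ℓ (d2Sample X C)).bind fun S => pick C S) i := by
  rw [step, PMF.bind_apply, tsum_fintype, Fintype.sum_bool]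
  simp [coin, PMF.ofFintype_apply]

theorem toReal_step_bounds (hpick : ∀ C S, ∀ u ∈ (pick C S).support, ∃ j, S j = u)
    {C : Finset ι} (h : 0 < seedCost X C) (i : ι) :
    (p : ℝ) * d2Prob X C i ≤ (step X p pick C i).toReal ∧
      (step X p pick C i).toReal ≤ ((1 - (p : ℝ)) * ℓ + p) * d2Prob X C i := by
  have h0 : (0 : ℝ) ≤ p := p.2.1
  have h1 : (0 : ℝ) ≤ 1 - p := sub_nonneg.2 p.2.2
  set B := ((iid ℓ (d2Sample X C)).bind fun S => pick C S) i with hB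
  have hBt : B ≠ ⊤ := PMF.apply_ne_top _ _
  have hdt : d2Sample X C i ≠ ⊤ := PMF.apply_ne_top _ _
  have hBle : B.toReal ≤ ℓ * d2Prob X C i := by
    have := ENNReal.toReal_mono (ENNReal.mul_ne_top (ENNReal.natCast_ne_top ℓ) hdt)
      (sum_iid_mul_le (d2Sample X C) (pick C) (hpick C) i)
    rwa [ENNReal.toReal_mul, ENNReal.toReal_natCast, toReal_d2Sample X h] at this
  have e : (step X p pick C i).toReal = p * d2Prob X C i + (1 - p) * B.toReal := by
    rw [step_apply, ENNReal.toReal_add (ENNReal.mul_ne_top ENNReal.ofReal_ne_top hdt)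
      (ENNReal.mul_ne_top ENNReal.ofReal_ne_top hBt), ENNReal.toReal_mul, ENNReal.toReal_mul,
      ENNReal.toReal_ofReal h0, ENNReal.toReal_ofReal h1, toReal_d2Sample X h]
  rw [e]
  constructor
  · exact le_add_of_nonneg_right (mul_nonneg h1 ENNReal.toReal_nonneg)
  · linarith [mul_le_mul_of_nonneg_left hBle h1]

theorem sum_toReal_eq_one {α : Type} [Fintype α] (μ : PMF α) : ∑ i, (μ i).toReal = 1 := by
  rw [← ENNReal.toReal_sum fun i _ => μ.apply_ne_top i, ← tsum_fintype (L := .unconditional α),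
    μ.tsum_coe, ENNReal.toReal_one]

theorem isNoisySampling_step (hpick : ∀ C S, ∀ u ∈ (pick C S).support, ∃ j, S j = u) :
    IsNoisySampling X p ((1 - (p : ℝ)) * ℓ + p) fun C i => (step X p pick C i).toReal where
  nonneg _ _ := ENNReal.toReal_nonneg
  sum_eq_one C := sum_toReal_eq_one _
  lower C _ i := by
    rw [← d2Prob_mul_seedCost, ← mul_assoc]
    rcases (seedCost_nonneg X C).eq_or_lt with h | h
    · simp [← h]
    · exact mul_le_mul_of_nonneg_right (toReal_step_bounds X p pick hpick h i).1 h.le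
  upper C _ i := by
    rw [← d2Prob_mul_seedCost, ← mul_assoc]
    rcases (seedCost_nonneg X C).eq_or_lt with h | h
    · simp [← h]
    · exact mul_le_mul_of_nonneg_right (toReal_step_bounds X p pick hpick h i).2 h.le

theorem sum_toReal_map_mul {α β : Type} [Fintype α] [Fintype β] (μ : PMF α) (g : α → β)
    (F : β → ℝ) : ∑ y, ((μ.map g) y).toReal * F y = ∑ x, (μ x).toReal * F (g x) := by
  classical
  have h : ∀ y, ((μ.map g) y).toReal = ∑ x, if y = g x then (μ x).toReal else 0 := by
    intro y
    rw [PMF.map_apply, tsum_fintype, ENNReal.toReal_sum fun x _ => ?_]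
    · exact Finset.sum_congr rfl fun x _ => by split_ifs <;> rfl
    · split_ifs
      exacts [μ.apply_ne_top x, ENNReal.zero_ne_top]
  simp only [h, Finset.sum_mul]
  rw [Finset.sum_comm]
  exact Finset.sum_congr rfl fun x _ => by simp [ite_mul]

theorem sum_toReal_bind_mul {α β : Type} [Fintype α] [Fintype β] (μ : PMF α) (g : α → PMF β)
    (F : β → ℝ) :
    ∑ y, ((μ.bind g) y).toReal * F y = ∑ x, (μ x).toReal * ∑ y, (g x y).toReal * F y := by
  have h : ∀ y, ((μ.bind g) y).toReal = ∑ x, (μ x).toReal * (g x y).toReal := by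
    intro y
    rw [PMF.bind_apply, tsum_fintype, ENNReal.toReal_sum fun x _ =>
      ENNReal.mul_ne_top (μ.apply_ne_top x) ((g x).apply_ne_top y)]
    exact Finset.sum_congr rfl fun x _ => ENNReal.toReal_mul
  simp only [h, Finset.sum_mul, Finset.mul_sum]
  rw [Finset.sum_comm]
  exact Finset.sum_congr rfl fun x _ => Finset.sum_congr rfl fun y _ => by ring

/-- Passes from the forward law to backward operators: averaging `F` over the last iteration first
turns the expectation into an iterate of `stepMean`. -/
theorem sum_centersLaw_mul [DecidableEq ι] (s : ℕ) (F : Finset ι → ℝ) :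
    ∑ C, (centersLaw X p pick (s + 1) C).toReal * F C
      = (Fintype.card ι : ℝ)⁻¹ *
        ∑ i, (stepMean fun C i => (step X p pick C i).toReal)^[s] F {i} := by
  induction s generalizing F with
  | zero =>
    rw [zero_add, centersLaw, sum_toReal_map_mul, Finset.mul_sum]
    exact Finset.sum_congr rfl fun i _ => by simp [PMF.uniformOfFintype_apply]
  | succ s ih =>
    rw [centersLaw, sum_toReal_bind_mul]
    simp only [sum_toReal_map_mul]
    rw [Function.iterate_succ_apply, ← ih]
    rfl

end Law

/-! ### The first center, the comparison with a clustering, and the final constant -/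

section Main

variable {ι κ : Type} [Fintype ι] [DecidableEq ι] [DecidableEq κ] {d : ℕ}

/-- After a uniformly random first center, the cost of its cluster plus `γ` times the optimal cost
of the other clusters is at most `γ` times the total optimal cost in expectation. -/
theorem sum_first_center_le (X : ι → Pt d) (f : ι → κ) (z : κ → Pt d) {γ : ℝ} (hγ : 2 ≤ γ) :
    ∑ i, (coveredCost X f {i} + γ * ∑ c ∈ uncovered f {i}, centerCost X f z c)
      ≤ Fintype.card ι * (γ * ∑ c ∈ Finset.univ.image f, centerCost X f z c) := by
  set O := ∑ c ∈ Finset.univ.image f, centerCost X f z c with hO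
  have h1 : ∀ i, coveredCost X f {i} + γ * ∑ c ∈ uncovered f {i}, centerCost X f z c
      ≤ γ * O + (∑ j with f j = f i, ‖X j - X i‖ ^ 2 - γ * centerCost X f z (f i)) := by
    intro i
    have h2 : ∑ c ∈ uncovered f {i}, centerCost X f z c + centerCost X f z (f i) = O := by
      rw [uncovered, Finset.image_singleton, Finset.sdiff_singleton_eq_erase]
      exact Finset.sum_erase_add _ _ (Finset.mem_image_of_mem f (Finset.mem_univ i))
    have h3 : coveredCost X f {i} ≤ ∑ j with f j = f i, ‖X j - X i‖ ^ 2 := by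
      rw [coveredCost, Finset.image_singleton, Finset.sum_singleton]
      exact clusterCost_insert_le_sum X f ∅ i (f i)
    rw [← h2]
    linarith
  refine (Finset.sum_le_sum fun i _ => h1 i).trans ?_
  rw [Finset.sum_add_distrib, Finset.sum_const, nsmul_eq_mul, Finset.card_univ]
  refine add_le_of_nonpos_right ?_
  rw [sum_eq_sum_image_fiber f]
  refine Finset.sum_nonpos fun c _ => ?_
  have h4 : ∑ i with f i = c, (∑ j with f j = f i, ‖X j - X i‖ ^ 2 - γ * centerCost X f z (f i))
      = ∑ i with f i = c, ∑ j with f j = c, ‖X j - X i‖ ^ 2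
        - (Finset.univ.filter fun i => f i = c).card * (γ * centerCost X f z c) := by
    rw [← nsmul_eq_mul, ← Finset.sum_const, ← Finset.sum_sub_distrib]
    exact Finset.sum_congr rfl fun i hi => by rw [(Finset.mem_filter.1 hi).2]
  rw [h4, sub_nonpos]
  refine (sum_sum_norm_sub_sq_le _ X (z c)).trans ?_
  rw [mul_comm 2, mul_assoc]
  exact mul_le_mul_of_nonneg_left
    (mul_le_mul_of_nonneg_right hγ (centerCost_nonneg X f z c)) (Nat.cast_nonneg _)

/-- The expected cost of noisy `k`-means++ compared with any clustering into at most `k`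
clusters. -/
theorem expectedCost_le_of_clustering [Nonempty ι] (X : ι → Pt d) (p : Set.Icc (0 : ℝ) 1)
    (hp : 0 < (p : ℝ)) {ℓ : ℕ} (pick : Finset ι → (Fin ℓ → ι) → PMF ι)
    (hpick : ∀ C S, ∀ u ∈ (pick C S).support, ∃ j, S j = u) {s : ℕ} (f : ι → κ) (z : κ → Pt d)
    (hf : (Finset.univ.image f).card ≤ s + 1) {γ : ℝ}
    (hγ : 8 * ((1 - (p : ℝ)) * ℓ + p) = γ * p) :
    expectedCost X p pick (s + 1)
      ≤ (1 + ((1 - (p : ℝ)) * ℓ + p) *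
          (2 * ((1 - (p : ℝ)) * ℓ + p) / p * Real.log (s + 1 : ℕ) + 3) * (harmonic s : ℝ)) *
        (γ * ∑ c ∈ Finset.univ.image f, centerCost X f z c) := by
  have h1 : (0 : ℝ) ≤ 1 - p := sub_nonneg.2 p.2.2
  have hq := isNoisySampling_step X p pick hpick
  set b : ℝ := (1 - (p : ℝ)) * ℓ + p with hb_def
  have hpb : (p : ℝ) ≤ b := le_add_of_nonneg_left (mul_nonneg h1 (Nat.cast_nonneg _))
  have hb : 0 < b := hp.trans_le hpb
  have hγ2 : 2 ≤ γ := by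
    by_contra! h
    nlinarith
  have hn : (0 : ℝ) < Fintype.card ι := by exact_mod_cast Fintype.card_pos
  have hL : 0 ≤ Real.log (s + 1 : ℕ) := Real.log_natCast_nonneg _
  have hH0 : (0 : ℝ) ≤ (harmonic s : ℝ) := by
    rw [harmonic]
    push_cast
    positivity
  set R : ℝ := 1 + b * (2 * b / p * Real.log (s + 1 : ℕ) + 3) * (harmonic s : ℝ) with hR
  have hR0 : 0 ≤ R := by positivity
  have hi : ∀ i, (stepMean fun C i => (step X p pick C i).toReal)^[s] (seedCost X) {i}
      ≤ R * (coveredCost X f {i} + γ * ∑ c ∈ uncovered f {i}, centerCost X f z c) := by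
    intro i
    -- The first center always covers one nonempty cluster, so the remaining `s` iterations suffice
    -- for the coefficient of the average term to become zero.
    have hcard : (uncovered f {i}).card ≤ s := by
      have : (uncovered f {i}).card + 1 = (Finset.univ.image f).card := by
        rw [uncovered, Finset.image_singleton, Finset.sdiff_singleton_eq_erase]
        exact Finset.card_erase_add_one (Finset.mem_image_of_mem f (Finset.mem_univ i))
      omega
    have h := hq.iterate_stepMean_seedCost_le f z hp hb hγ.le (k := s + 1) s
      (Finset.singleton_nonempty i) (hcard.trans (Nat.le_succ s))
    rwa [Nat.sub_eq_zero_of_le hcard, Nat.cast_zero, zero_mul, zero_add] at h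
  rw [expectedCost, sum_centersLaw_mul]
  calc (Fintype.card ι : ℝ)⁻¹ *
        ∑ i, (stepMean fun C i => (step X p pick C i).toReal)^[s] (seedCost X) {i}
      ≤ (Fintype.card ι : ℝ)⁻¹ * ∑ i, R *
          (coveredCost X f {i} + γ * ∑ c ∈ uncovered f {i}, centerCost X f z c) := by
        gcongr with i
        exact hi i
    _ ≤ (Fintype.card ι : ℝ)⁻¹ * (R *
          (Fintype.card ι * (γ * ∑ c ∈ Finset.univ.image f, centerCost X f z c))) := by
        rw [← Finset.mul_sum]
        gcongr
        exact sum_first_center_le X f z hγ2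
    _ = _ := by
        field_simp

/-- Each point is labelled by a nearest center; the labels serve as reference centers. -/
theorem exists_clustering (X : ι → Pt d) {C : Finset (Pt d)} (hC : C.Nonempty) :
    ∃ f : ι → Pt d, Finset.univ.image f ⊆ C ∧
      ∑ c ∈ Finset.univ.image f, centerCost X f id c = cost X (C : Set (Pt d)) := by
  choose f hfC hf using fun i => exists_pointCost_eq (X i) (Finset.coe_nonempty.2 hC)
    C.finite_toSet
  refine ⟨f, fun c hc => ?_, ?_⟩
  · obtain ⟨i, _, rfl⟩ := Finset.mem_image.1 hc
    exact hfC i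
  · rw [cost, sum_eq_sum_image_fiber f]
    refine Finset.sum_congr rfl fun c _ => Finset.sum_congr rfl fun i hi => ?_
    rw [hf, (Finset.mem_filter.1 hi).2, id]

theorem expectedCost_le_mul_optCost [Nonempty ι] (X : ι → Pt d) (p : Set.Icc (0 : ℝ) 1)
    (hp : 0 < (p : ℝ)) {ℓ : ℕ} (hℓ : 1 ≤ ℓ) (pick : Finset ι → (Fin ℓ → ι) → PMF ι)
    (hpick : ∀ C S, ∀ u ∈ (pick C S).support, ∃ j, S j = u) {k : ℕ} (hk : 2 ≤ k) :
    expectedCost X p pick k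
      ≤ 224 / (p : ℝ) ^ 2 * (ℓ : ℝ) ^ 3 * Real.log k ^ 2 * optCost k X := by
  obtain ⟨s, rfl⟩ : ∃ s, k = s + 1 := ⟨k - 1, by omega⟩
  have h1 : (0 : ℝ) ≤ 1 - p := sub_nonneg.2 p.2.2
  have hp1 : (p : ℝ) ≤ 1 := p.2.2
  have hℓ1 : (1 : ℝ) ≤ ℓ := by exact_mod_cast hℓ
  set b : ℝ := (1 - (p : ℝ)) * ℓ + p with hb_def
  set L := Real.log (s + 1 : ℕ) with hL
  have hbℓ : b ≤ ℓ := by nlinarith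
  have hb : 0 < b := by positivity
  -- `log 2 > 1/2` lets additive constants be absorbed into multiples of `L`.
  have hL2 : 1 ≤ 2 * L := by
    have h2 : Real.log 2 ≤ L := Real.log_le_log (by norm_num) (by exact_mod_cast hk)
    linarith [Real.log_two_gt_d9]
  have hH : (harmonic s : ℝ) ≤ 3 * L := by
    have h2 := harmonic_le_one_add_log s
    have h3 : Real.log s ≤ L := by
      rcases Nat.eq_zero_or_pos s with h | h
      · omega
      · exact Real.log_le_log (by exact_mod_cast h) (by push_cast; linarith)
    linarith
  have hH0 : (0 : ℝ) ≤ (harmonic s : ℝ) := by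
    rw [harmonic]
    push_cast
    positivity
  have hbp : 0 ≤ b / p := by positivity
  have hℓp : 1 ≤ (ℓ : ℝ) / p := by rw [one_le_div hp]; linarith
  have hbℓp : b / p ≤ ℓ / p := by gcongr
  have hM : 2 * b / p * L + 3 ≤ 8 * (ℓ / p) * L := by
    have h4 : 2 * b / p * L = 2 * (b / p) * L := by ring
    nlinarith
  have hconst : (1 + b * (2 * b / p * L + 3) * (harmonic s : ℝ)) * (8 * b / p)
      ≤ 224 / (p : ℝ) ^ 2 * (ℓ : ℝ) ^ 3 * L ^ 2 := by
    have hone : 1 ≤ 4 * ((ℓ : ℝ) * (ℓ / (p : ℝ)) * L ^ 2) := by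
      have h5 : 1 ≤ (ℓ : ℝ) * (ℓ / (p : ℝ)) := one_le_mul_of_one_le_of_one_le hℓ1 hℓp
      have h6 : 1 ≤ 4 * L ^ 2 := by nlinarith
      linarith [mul_le_mul_of_nonneg_right h5 (sq_nonneg L)]
    have hL0 : 0 ≤ L := by linarith
    -- The constant is `(4 + 8 · 3) · 8 = 224`.
    calc (1 + b * (2 * b / p * L + 3) * (harmonic s : ℝ)) * (8 * b / p)
        ≤ (4 * ((ℓ : ℝ) * (ℓ / (p : ℝ)) * L ^ 2) + ℓ * (8 * (ℓ / p) * L) * (3 * L)) *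
            (8 * ℓ / p) := by
          gcongr
      _ = _ := by ring
  have : Nonempty {C : Finset (Pt d) // C.Nonempty ∧ C.card ≤ s + 1} :=
    ⟨{0}, Finset.singleton_nonempty _, by simp⟩
  rw [optCost, Real.mul_iInf_of_nonneg (by positivity)]
  refine le_ciInf fun ⟨C, hC, hCk⟩ => ?_
  obtain ⟨f, hfC, hf⟩ := exists_clustering X hC
  have h := expectedCost_le_of_clustering X p hp pick hpick f id
    ((Finset.card_le_card hfC).trans hCk) (γ := 8 * b / p)
    (by rw [div_mul_cancel₀ _ hp.ne'])
  rw [hf, ← mul_assoc] at h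
  exact h.trans (mul_le_mul_of_nonneg_right hconst
    (Finset.sum_nonneg fun _ _ => pointCost_nonneg _ _))

end Main

end KMeans

theorem mainTheorem3 :
    (∀ (p : Set.Icc (0 : ℝ) 1) (ℓ : ℕ), 1 ≤ ℓ →
      ∀ (d n : ℕ) [NeZero n] (X : Fin n → KMeans.Pt d)
        (pick : Finset (Fin n) → (Fin ℓ → Fin n) → PMF (Fin n)),
        KMeans.IsArgminRule X ℓ pick →
        ∀ C : Finset (Fin n), C.Nonempty → 0 < KMeans.seedCost X C → ∀ i : Fin n,
          (p : ℝ) * KMeans.d2Prob X C i ≤ (KMeans.step X p pick C i).toReal ∧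
          (KMeans.step X p pick C i).toReal ≤
            ((1 - (p : ℝ)) * ℓ + p) * KMeans.d2Prob X C i) ∧
    (∀ p : Set.Icc (0 : ℝ) 1, 0 < (p : ℝ) →
      ∃ K : ℝ, 0 < K ∧
        ∀ (ℓ : ℕ), 1 ≤ ℓ → ∀ k : ℕ, 2 ≤ k →
          max 18 (24 * ((1 - (p : ℝ)) * ℓ) * ((1 - (p : ℝ)) * ℓ + p) / (p : ℝ) ^ 2)
            ≤ (k : ℝ) / Real.log k →
          ∀ (d n : ℕ) [NeZero n] (X : Fin n → KMeans.Pt d)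
            (pick : Finset (Fin n) → (Fin ℓ → Fin n) → PMF (Fin n)),
            KMeans.IsArgminRule X ℓ pick →
            KMeans.expectedCost X p pick k
              ≤ K * (ℓ : ℝ) ^ 3 * Real.log k ^ 2 * KMeans.optCost k X) := by
  constructor
  · intro p ℓ _ d n _ X pick hpick C _ hΦ i
    exact KMeans.toReal_step_bounds X p pick (fun C S u hu => (hpick C S u hu).1) hΦ i
  · intro p hp
    refine ⟨224 / (p : ℝ) ^ 2, by positivity, fun ℓ hℓ k hk _ d n _ X pick hpick => ?_⟩
    exact KMeans.expectedCost_le_mul_optCost X p hp hℓ pick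
      (fun C S u hu => (hpick C S u hu).1) hk
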